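/- Let $M_d$ denote the complex $d\times d$ matrices, and call positive semidefinite matrices of unit trace states. A quantum channel is a completely positive trace-preserving linear map $\Phi:M_d\to M_{d_{\rm out}}$. A map $\Phi_c:M_d\to M_{d_{\rm env}}$ is complementary to $\Phi$ if there is an isometry $V:\mathbb C^d\to\mathbb C^{d_{\rm out}}\otimes\mathbb C^{d_{\rm env}}$ with $\Phi(X)=\operatorname{Tr}_{\rm env}(VXV^\dagger)$ and $\Phi_c(X)=\operatorname{Tr}_{\rm out}(VXV^\dagger)$ for all $X\in M_d$; let $\mathcal C_\Phi$ be the set of all channels complementary to $\Phi$ (over all $d_{\rm env}$). Let $d^*_{\rm env}(\Phi)$ be the least $d_{\rm env}$ for which some $\Phi_c:M_d\to M_{d_{\rm env}}$ lies in $\mathcal C_\Phi$, and let $d^*_{\rm out}(\Phi):=d^*_{\rm env}(\Phi_c)$ for $\Phi_c\in\mathcal C_\Phi$ (this does not depend on the choice of $\Phi_c$). With the von Neumann entropy $S(\rho)=-\operatorname{Tr}(\rho\log\rho)$, put $$\mathcal Q^{(1)}(\Phi):=\max_{\rho\ \text{state}}\bigl(S(\Phi(\rho))-S(\Phi_c(\rho))\bigr),\qquad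 \mathcal Q(\Phi):=\lim_{n\to\infty}\frac{\mathcal Q^{(1)}(\Phi^{\otimes n})}{n},$$ where $\Phi_c\in\mathcal C_\Phi$ (again the choice is immaterial); $\mathcal Q(\Phi)$ is the quantum capacity of $\Phi$ in its regularized form. Corollary. Let $\Phi:M_d\to M_{d_{\rm out}}$ be a quantum channel such that there is a pure state $|\psi\rangle\langle\psi|\in M_d$ with $\operatorname{rank}\Phi(|\psi\rangle\langle\psi|)=\min\{d^*_{\rm out}(\Phi),d^*_{\rm env}(\Phi)\}$. (i) If $d^*_{\rm out}(\Phi)>d^*_{\rm env}(\Phi)$, then the limit defining $\mathcal Q(\Phi)$ exists and $\mathcal Q(\Phi)\ge\mathcal Q^{(1)}(\Phi)>0$. (ii) If $d^*_{\rm out}(\Phi)<d^*_{\rm env}(\Phi)$, then for every $\Phi_c\in\mathcal C_\Phi$ the limit defining $\mathcal Q(\Phi_c)$ exists and $\mathcal Q(\Phi_c)\ge\mathcal Q^{(1)}(\Phi_c)>0$. -/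

import Mathlib

open Filter Topology
open scoped ComplexOrder Matrix

namespace QuantumChannel

noncomputable section

/-- Linear maps from `a × a` to `b × b` complex matrices. -/
abbrev MatMap (a b : Type*) := Matrix a a ℂ →ₗ[ℂ] Matrix b b ℂ

/-- Quantum states: positive semidefinite matrices of unit trace. -/
def IsState {a : Type*} [Fintype a] (ρ : Matrix a a ℂ) : Prop :=
  ρ.PosSemidef ∧ ρ.trace = 1

/-- Pure states: the rank-one projections `|ψ⟩⟨ψ|` onto unit vectors `ψ`. -/
def IsPureState {a : Type*} [Fintype a] (ρ : Matrix a a ℂ) : Prop :=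
  ∃ ψ : a → ℂ, star ψ ⬝ᵥ ψ = 1 ∧ ρ = Matrix.vecMulVec ψ (star ψ)

/-- The map `id ⊗ Φ` on block matrices: `Φ` is applied to every block. -/
def ampliate {a b : Type*} (Φ : MatMap a b) (k : ℕ)
    (X : Matrix (Fin k × a) (Fin k × a) ℂ) : Matrix (Fin k × b) (Fin k × b) ℂ :=
  Matrix.of fun p q => Φ (Matrix.of fun i j => X (p.1, i) (q.1, j)) p.2 q.2

/-- Complete positivity: `id_k ⊗ Φ` preserves positive semidefiniteness for every `k`. -/
def IsCompletelyPositive {a b : Type*} [Fintype a] [Fintype b] (Φ : MatMap a b) : Prop :=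
  ∀ (k : ℕ) (X : Matrix (Fin k × a) (Fin k × a) ℂ),
    X.PosSemidef → (ampliate Φ k X).PosSemidef

/-- Quantum channels: completely positive, trace preserving linear maps. -/
def IsChannel {a b : Type*} [Fintype a] [Fintype b] (Φ : MatMap a b) : Prop :=
  IsCompletelyPositive Φ ∧ ∀ X : Matrix a a ℂ, (Φ X).trace = X.trace

/-- Partial trace over the second tensor factor (the environment). -/
def traceEnv {b e : Type*} [Fintype e] (Z : Matrix (b × e) (b × e) ℂ) : Matrix b b ℂ :=
  Matrix.of fun i j => ∑ k, Z (i, k) (j, k)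

/-- Partial trace over the first tensor factor (the output). -/
def traceOut {b e : Type*} [Fintype b] (Z : Matrix (b × e) (b × e) ℂ) : Matrix e e ℂ :=
  Matrix.of fun k l => ∑ i, Z (i, k) (i, l)

/-- `Φ` and `Φc` are complementary: there is an isometry `V : ℂ^a → ℂ^b ⊗ ℂ^e` with
`Φ X = Tr_env (V X V†)` and `Φc X = Tr_out (V X V†)` for all `X`.
(Both maps are then automatically quantum channels.) -/
def IsComplementary {a b e : Type*} [Fintype a] [DecidableEq a] [Fintype b] [Fintype e]
    (Φ : MatMap a b) (Φc : MatMap a e) : Prop :=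
  ∃ V : Matrix (b × e) a ℂ, Vᴴ * V = 1 ∧
    ∀ X : Matrix a a ℂ, Φ X = traceEnv (V * X * Vᴴ) ∧ Φc X = traceOut (V * X * Vᴴ)

/-- Minimal environment dimension: the least `e` such that some `Φc : M_a → M_e` is
complementary to `Φ`. -/
def minEnvDim {a b : Type*} [Fintype a] [DecidableEq a] [Fintype b] (Φ : MatMap a b) : ℕ :=
  sInf {e : ℕ | ∃ Φc : MatMap a (Fin e), IsComplementary Φ Φc}

/-- Minimal output dimension: the minimal environment dimension of a complementary channel.
For a channel `Φ` all complementary channels have the same minimal environment dimension, so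
the set below has exactly one element. -/
def minOutDim {a b : Type*} [Fintype a] [DecidableEq a] [Fintype b] (Φ : MatMap a b) : ℕ :=
  sInf {m : ℕ | ∃ (e : ℕ) (Φc : MatMap a (Fin e)), IsComplementary Φ Φc ∧ m = minEnvDim Φc}

/-- Von Neumann entropy `S(ρ) = -Tr (ρ log ρ)`; the logarithm is the functional calculus of the
real natural logarithm, whose value at `0` is `0`, so that `0 log 0 = 0`. -/
def entropy {a : Type*} [Fintype a] [DecidableEq a] (ρ : Matrix a a ℂ) : ℝ :=
  -(ρ * cfc Real.log ρ).trace.re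

/-- `S(Φ ρ) - S(Φc ρ)`, the coherent information of the state `ρ` with respect to `Φ`
when `Φc` is complementary to `Φ`. -/
def coherentInfoAt {a b e : Type*} [Fintype b] [DecidableEq b] [Fintype e] [DecidableEq e]
    (Φ : MatMap a b) (Φc : MatMap a e) (ρ : Matrix a a ℂ) : ℝ :=
  entropy (Φ ρ) - entropy (Φc ρ)

/-- The coherent information `Q⁽¹⁾(Φ)` of a channel: the maximum over states `ρ` of
`S(Φ ρ) - S(Φc ρ)`, with `Φc` complementary to `Φ`. This difference depends only on `ρ` and `Φ`
and not on the complementary channel, so letting `Φc` range over all of them is immaterial. -/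
def coherentInfo {a b : Type*} [Fintype a] [DecidableEq a] [Fintype b] [DecidableEq b]
    (Φ : MatMap a b) : ℝ :=
  sSup {x : ℝ | ∃ (e : ℕ) (Φc : MatMap a (Fin e)) (ρ : Matrix a a ℂ),
    IsComplementary Φ Φc ∧ IsState ρ ∧ x = coherentInfoAt Φ Φc ρ}

/-- The tensor power `Φ^{⊗n}`, with the basis of `(ℂ^a)^{⊗n}` indexed by `Fin n → a`: the linear
map sending the matrix unit `⊗ₜ |kₜ⟩⟨lₜ|` to `⊗ₜ Φ(|kₜ⟩⟨lₜ|)`. -/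
def tensorPower {a b : Type*} [Fintype a] [DecidableEq a] (Φ : MatMap a b) (n : ℕ) :
    MatMap (Fin n → a) (Fin n → b) where
  toFun X := Matrix.of fun i j =>
    ∑ k, ∑ l, X k l * ∏ t, Φ (Matrix.single (k t) (l t) 1) (i t) (j t)
  map_add' X Y := by
    ext i j
    simp [add_mul, Finset.sum_add_distrib]
  map_smul' c X := by
    ext i j
    simp [mul_assoc, Finset.mul_sum]

/-- On product matrices the tensor power acts factor by factor. -/
theorem tensorPower_product {a b : Type*} [Fintype a] [DecidableEq a] (Φ : MatMap a b) (n : ℕ)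
    (X : Fin n → Matrix a a ℂ) :
    tensorPower Φ n (Matrix.of fun k l => ∏ t, X t (k t) (l t)) =
      Matrix.of fun i j => ∏ t, Φ (X t) (i t) (j t) := by
  ext i j
  have h : ∀ t, Φ (X t) (i t) (j t) =
      ∑ k, ∑ l, X t k l * Φ (Matrix.single k l 1) (i t) (j t) := by
    intro t
    conv_lhs => rw [Matrix.matrix_eq_sum_single (X t)]
    simp only [map_sum, Matrix.sum_apply]
    refine Finset.sum_congr rfl fun k _ => Finset.sum_congr rfl fun l _ => ?_
    have : Matrix.single k l (X t k l) = X t k l • Matrix.single k l (1 : ℂ) := by simp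
    rw [this, map_smul, Matrix.smul_apply, smul_eq_mul]
  simp only [tensorPower, LinearMap.coe_mk, AddHom.coe_mk, Matrix.of_apply, h,
    Fintype.prod_sum, Finset.prod_mul_distrib]

/-- The sequence `Q⁽¹⁾(Φ^{⊗n}) / n`, whose limit is the quantum capacity. -/
def capacitySeq {a b : Type*} [Fintype a] [DecidableEq a] [Fintype b] [DecidableEq b]
    (Φ : MatMap a b) (n : ℕ) : ℝ :=
  coherentInfo (tensorPower Φ n) / n

/-- The quantum capacity `Q(Φ) = lim_{n → ∞} Q⁽¹⁾(Φ^{⊗n}) / n`. -/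
def quantumCapacity {a b : Type*} [Fintype a] [DecidableEq a] [Fintype b] [DecidableEq b]
    (Φ : MatMap a b) : ℝ :=
  limUnder atTop (capacitySeq Φ)

end

end QuantumChannel

namespace QuantumChannel


/-! ### Spectral formulas for the entropy, Klein's inequality, basic entropy bounds. -/

section Entropy

open Matrix

variable {a b : Type*} [Fintype a] [DecidableEq a] [Fintype b] [DecidableEq b]

/-! The theorem rests on the logarithmic singularity of the entropy at rank-deficient states. A pure
input `P` is sent by `Φ` and `Φc` to states with the same nonzero spectrum, so the coherent
information at `P` is zero. The minimal dimensions are `minEnvDim Φ = rank (Φc 1)` and `minOutDim Φ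
= rank (Φ 1)` (`IsComplementary.minEnvDim_eq`, `minOutDim_eq`). In case (i), once both outputs are
compressed to these supports, `Φc P` has full rank while `Φ P` does not.

Now perturb `P` to `(1 - t) P + t τ` with `τ` maximally mixed. Klein's inequality gives output
entropy at least `(1 - t) S(Φ P) + c t log (1 / t)` with `c > 0` (`exists_entropy_mix_ge`), and
environment entropy at most `(1 - t) S(Φc P) + K t` (`entropy_mix_le`). The first terms agree, so
the coherent information is positive for small `t`. Case (ii) is case (i) with the two channels
exchanged.

Convergence of the regularization is Fekete's lemma: product inputs make the coherent information
superadditive over tensor powers (`tendsto_capacitySeq`). -/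

theorem cfc_eq_conj {σ : Matrix a a ℂ} (hσ : σ.IsHermitian) (f : ℝ → ℝ) :
    cfc f σ = (hσ.eigenvectorUnitary : Matrix a a ℂ) *
      diagonal (fun i => ((f (hσ.eigenvalues i) : ℝ) : ℂ)) *
      (hσ.eigenvectorUnitary : Matrix a a ℂ)ᴴ := by
  rw [hσ.cfc_eq, IsHermitian.cfc, Unitary.conjStarAlgAut_apply]
  rfl

theorem eq_conj_diagonal_eigenvalues {σ : Matrix a a ℂ} (hσ : σ.IsHermitian) :
    σ = (hσ.eigenvectorUnitary : Matrix a a ℂ) *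
      diagonal (fun i => ((hσ.eigenvalues i : ℝ) : ℂ)) *
      (hσ.eigenvectorUnitary : Matrix a a ℂ)ᴴ := by
  conv_lhs => rw [hσ.spectral_theorem, Unitary.conjStarAlgAut_apply]
  rfl

theorem conjTranspose_eigenvectorUnitary_mul {σ : Matrix a a ℂ} (hσ : σ.IsHermitian) :
    (hσ.eigenvectorUnitary : Matrix a a ℂ)ᴴ * (hσ.eigenvectorUnitary : Matrix a a ℂ) = 1 :=
  Unitary.coe_star_mul_self hσ.eigenvectorUnitary

theorem eigenvectorUnitary_mul_conjTranspose {σ : Matrix a a ℂ} (hσ : σ.IsHermitian) :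
    (hσ.eigenvectorUnitary : Matrix a a ℂ) * (hσ.eigenvectorUnitary : Matrix a a ℂ)ᴴ = 1 :=
  Unitary.coe_mul_star_self hσ.eigenvectorUnitary

/-- The diagonal entries of `X` in the eigenbasis of the Hermitian matrix `σ`. -/
noncomputable def eigenDiag {σ : Matrix a a ℂ} (hσ : σ.IsHermitian) (X : Matrix a a ℂ) (j : a) :
    ℝ :=
  (((hσ.eigenvectorUnitary : Matrix a a ℂ)ᴴ * X * (hσ.eigenvectorUnitary : Matrix a a ℂ)) j j).re

theorem trace_mul_cfc {σ : Matrix a a ℂ} (hσ : σ.IsHermitian) (X : Matrix a a ℂ) (f : ℝ → ℝ) :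
    (X * cfc f σ).trace.re = ∑ j, f (hσ.eigenvalues j) * eigenDiag hσ X j := by
  rw [cfc_eq_conj hσ, ← Matrix.mul_assoc, trace_mul_comm, ← Matrix.mul_assoc, ← Matrix.mul_assoc]
  simp [trace, eigenDiag, mul_diagonal, mul_comm]

theorem eigenDiag_self {σ : Matrix a a ℂ} (hσ : σ.IsHermitian) (j : a) :
    eigenDiag hσ σ j = hσ.eigenvalues j := by
  have h : (hσ.eigenvectorUnitary : Matrix a a ℂ)ᴴ * σ * (hσ.eigenvectorUnitary : Matrix a a ℂ) =
      diagonal (fun i => ((hσ.eigenvalues i : ℝ) : ℂ)) := by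
    rw [show (hσ.eigenvectorUnitary : Matrix a a ℂ)ᴴ * σ = _ from
      congrArg ((hσ.eigenvectorUnitary : Matrix a a ℂ)ᴴ * ·) (eq_conj_diagonal_eigenvalues hσ)]
    simp only [Matrix.mul_assoc]
    rw [conjTranspose_eigenvectorUnitary_mul, Matrix.mul_one, ← Matrix.mul_assoc,
      conjTranspose_eigenvectorUnitary_mul, Matrix.one_mul]
  simp [eigenDiag, h]

theorem eigenDiag_add {σ : Matrix a a ℂ} (hσ : σ.IsHermitian) (X Y : Matrix a a ℂ) (j : a) :
    eigenDiag hσ (X + Y) j = eigenDiag hσ X j + eigenDiag hσ Y j := by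
  simp [eigenDiag, Matrix.mul_add, Matrix.add_mul]

theorem eigenDiag_smul {σ : Matrix a a ℂ} (hσ : σ.IsHermitian) (t : ℝ) (X : Matrix a a ℂ) (j : a) :
    eigenDiag hσ ((t : ℂ) • X) j = t * eigenDiag hσ X j := by
  simp [eigenDiag]

theorem eigenDiag_nonneg {σ : Matrix a a ℂ} (hσ : σ.IsHermitian) {X : Matrix a a ℂ}
    (hX : X.PosSemidef) (j : a) : 0 ≤ eigenDiag hσ X j :=
  (Complex.le_def.1 ((hX.conjTranspose_mul_mul_same _).diag_nonneg (i := j))).1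

theorem sum_eigenDiag {σ : Matrix a a ℂ} (hσ : σ.IsHermitian) (X : Matrix a a ℂ) :
    ∑ j, eigenDiag hσ X j = X.trace.re := by
  have : X.trace = ((hσ.eigenvectorUnitary : Matrix a a ℂ)ᴴ * X *
      (hσ.eigenvectorUnitary : Matrix a a ℂ)).trace := by
    rw [trace_mul_comm, ← Matrix.mul_assoc, eigenvectorUnitary_mul_conjTranspose, Matrix.one_mul]
  rw [this]
  simp [eigenDiag, trace]

theorem trace_re_eq_sum_eigenvalues {σ : Matrix a a ℂ} (hσ : σ.IsHermitian) :
    σ.trace.re = ∑ j, hσ.eigenvalues j := by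
  simp [← sum_eigenDiag hσ σ, eigenDiag_self]

/-- The transition probabilities between the eigenbases of two Hermitian matrices. -/
noncomputable def overlap {ρ σ : Matrix a a ℂ} (hρ : ρ.IsHermitian) (hσ : σ.IsHermitian)
    (i j : a) : ℝ :=
  Complex.normSq (((hσ.eigenvectorUnitary : Matrix a a ℂ)ᴴ *
    (hρ.eigenvectorUnitary : Matrix a a ℂ)) j i)

theorem overlap_nonneg {ρ σ : Matrix a a ℂ} (hρ : ρ.IsHermitian) (hσ : σ.IsHermitian) (i j : a) :
    0 ≤ overlap hρ hσ i j := Complex.normSq_nonneg _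

theorem sum_normSq_row {U : Matrix a a ℂ} (hU : U * Uᴴ = 1) (j : a) :
    ∑ i, Complex.normSq (U j i) = 1 := by
  have := congrFun (congrFun hU j) j
  rw [mul_apply] at this
  simp only [conjTranspose_apply, one_apply_eq, RCLike.star_def, Complex.mul_conj] at this
  exact_mod_cast this

theorem sum_normSq_col {U : Matrix a a ℂ} (hU : Uᴴ * U = 1) (i : a) :
    ∑ j, Complex.normSq (U j i) = 1 := by
  have := congrFun (congrFun hU i) i
  rw [mul_apply] at this
  simp only [conjTranspose_apply, one_apply_eq, RCLike.star_def, ← Complex.normSq_eq_conj_mul_self]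
    at this
  exact_mod_cast this

theorem sum_overlap_left {ρ σ : Matrix a a ℂ} (hρ : ρ.IsHermitian) (hσ : σ.IsHermitian) (j : a) :
    ∑ i, overlap hρ hσ i j = 1 := by
  refine sum_normSq_row ?_ j
  rw [conjTranspose_mul, conjTranspose_conjTranspose, Matrix.mul_assoc,
    ← Matrix.mul_assoc (hρ.eigenvectorUnitary : Matrix a a ℂ),
    eigenvectorUnitary_mul_conjTranspose, Matrix.one_mul, conjTranspose_eigenvectorUnitary_mul]

theorem sum_overlap_right {ρ σ : Matrix a a ℂ} (hρ : ρ.IsHermitian) (hσ : σ.IsHermitian) (i : a) :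
    ∑ j, overlap hρ hσ i j = 1 := by
  refine sum_normSq_col ?_ i
  rw [conjTranspose_mul, conjTranspose_conjTranspose, Matrix.mul_assoc,
    ← Matrix.mul_assoc (hσ.eigenvectorUnitary : Matrix a a ℂ),
    eigenvectorUnitary_mul_conjTranspose, Matrix.one_mul, conjTranspose_eigenvectorUnitary_mul]

theorem eigenDiag_eq_sum {ρ σ : Matrix a a ℂ} (hρ : ρ.IsHermitian) (hσ : σ.IsHermitian) (j : a) :
    eigenDiag hσ ρ j = ∑ i, hρ.eigenvalues i * overlap hρ hσ i j := by
  set W := (hσ.eigenvectorUnitary : Matrix a a ℂ)ᴴ * (hρ.eigenvectorUnitary : Matrix a a ℂ) with hW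
  have h : (hσ.eigenvectorUnitary : Matrix a a ℂ)ᴴ * ρ * (hσ.eigenvectorUnitary : Matrix a a ℂ) =
      W * diagonal (fun i => ((hρ.eigenvalues i : ℝ) : ℂ)) * Wᴴ := by
    conv_lhs => rw [eq_conj_diagonal_eigenvalues hρ]
    simp only [hW, conjTranspose_mul, conjTranspose_conjTranspose, Matrix.mul_assoc]
  rw [eigenDiag, h, mul_apply, Complex.re_sum]
  refine Finset.sum_congr rfl fun i _ => ?_
  rw [mul_diagonal, conjTranspose_apply, mul_right_comm, RCLike.star_def, Complex.mul_conj,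
    ← Complex.ofReal_mul, Complex.ofReal_re, mul_comm]
  rfl

theorem entropy_eq_sum {ρ : Matrix a a ℂ} (hρ : ρ.IsHermitian) :
    entropy ρ = ∑ i, Real.negMulLog (hρ.eigenvalues i) := by
  rw [entropy, trace_mul_cfc hρ, ← Finset.sum_neg_distrib]
  refine Finset.sum_congr rfl fun i _ => ?_
  rw [eigenDiag_self, Real.negMulLog]
  ring

/-- The multiset of roots lets spectra be compared across different index types without matching
orderings of eigenvalues. -/
theorem entropy_eq_roots {ρ : Matrix a a ℂ} (hρ : ρ.IsHermitian) :
    entropy ρ = (ρ.charpoly.roots.map fun z => Real.negMulLog z.re).sum := by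
  rw [entropy_eq_sum hρ, hρ.roots_charpoly_eq_eigenvalues, Multiset.map_map]
  rfl

theorem entropy_congr_of_charpoly {ρ : Matrix a a ℂ} {σ : Matrix b b ℂ} (hρ : ρ.IsHermitian)
    (hσ : σ.IsHermitian) (h : ρ.charpoly = σ.charpoly) : entropy ρ = entropy σ := by
  rw [entropy_eq_roots hρ, entropy_eq_roots hσ, h]

/-- The entropy only depends on the nonzero spectrum: `AB` and `BA` have the same entropy. -/
theorem entropy_mul_comm (A : Matrix a b ℂ) (B : Matrix b a ℂ) (h₁ : (A * B).IsHermitian)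
    (h₂ : (B * A).IsHermitian) : entropy (A * B) = entropy (B * A) := by
  rw [entropy_eq_roots h₁, entropy_eq_roots h₂]
  -- The two characteristic polynomials agree up to powers of `X`; the extra roots are zeros and
  -- contribute `negMulLog 0 = 0`.
  have h := congrArg Polynomial.roots (charpoly_mul_comm' A B)
  have hX : ∀ n : ℕ, (Polynomial.X ^ n : Polynomial ℂ) ≠ 0 := fun n => pow_ne_zero _ Polynomial.X_ne_zero
  rw [Polynomial.roots_mul (mul_ne_zero (hX _) (charpoly_monic _).ne_zero),
    Polynomial.roots_mul (mul_ne_zero (hX _) (charpoly_monic _).ne_zero),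
    Polynomial.roots_X_pow, Polynomial.roots_X_pow] at h
  have h' := congrArg (fun s => (s.map fun z : ℂ => Real.negMulLog z.re).sum) h
  simpa [Multiset.map_nsmul, Multiset.sum_nsmul] using h'

theorem entropy_transpose {ρ : Matrix a a ℂ} (hρ : ρ.IsHermitian) : entropy ρᵀ = entropy ρ :=
  entropy_congr_of_charpoly hρ.transpose hρ (charpoly_transpose ρ)

theorem entropy_submatrix {ρ : Matrix a a ℂ} (hρ : ρ.IsHermitian) (e : b ≃ a) :
    entropy (ρ.submatrix e e) = entropy ρ :=
  entropy_congr_of_charpoly (hρ.submatrix e) hρ (by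
    rw [← charpoly_reindex e.symm ρ]; rfl)

theorem entropy_diagonal (d : a → ℝ) :
    entropy (diagonal fun i => (d i : ℂ)) = ∑ i, Real.negMulLog (d i) := by
  have h : (diagonal fun i => (d i : ℂ)).IsHermitian := by
    simp [IsHermitian, diagonal_conjTranspose, Pi.star_def]
  rw [entropy_eq_roots h, charpoly_diagonal, Polynomial.roots_prod _ _
    (Finset.prod_ne_zero_iff.2 fun i _ => Polynomial.X_sub_C_ne_zero _)]
  simp

theorem entropy_conj_diagonal {U : Matrix a a ℂ} (hU : Uᴴ * U = 1) (d : a → ℝ) :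
    entropy (U * (diagonal fun i => (d i : ℂ)) * Uᴴ) = ∑ i, Real.negMulLog (d i) := by
  have h : (diagonal fun i => (d i : ℂ)).IsHermitian := by
    simp [IsHermitian, diagonal_conjTranspose, Pi.star_def]
  have hB : Uᴴ * (U * diagonal fun i => (d i : ℂ)) = diagonal fun i => (d i : ℂ) := by
    rw [← Matrix.mul_assoc, hU, Matrix.one_mul]
  rw [entropy_mul_comm, hB, entropy_diagonal]
  · exact isHermitian_mul_mul_conjTranspose _ h
  · rwa [hB]

open Kronecker in
-- The eigenvalues are the products `p i * q j`, and `negMulLog (p q) = q negMulLog p + p negMulLog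
-- q`; summing the weights to one separates the terms.
theorem entropy_kronecker {ρ : Matrix a a ℂ} {σ : Matrix b b ℂ} (hρ : ρ.IsHermitian)
    (hσ : σ.IsHermitian) (hρ1 : ρ.trace = 1) (hσ1 : σ.trace = 1) :
    entropy (ρ ⊗ₖ σ) = entropy ρ + entropy σ := by
  have hr : ∑ i, hρ.eigenvalues i = 1 := by rw [← trace_re_eq_sum_eigenvalues, hρ1]; rfl
  have hs : ∑ i, hσ.eigenvalues i = 1 := by rw [← trace_re_eq_sum_eigenvalues, hσ1]; rfl
  have h : ρ ⊗ₖ σ = ((hρ.eigenvectorUnitary : Matrix a a ℂ) ⊗ₖ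
      (hσ.eigenvectorUnitary : Matrix b b ℂ)) *
      (diagonal fun i : a × b => ((hρ.eigenvalues i.1 * hσ.eigenvalues i.2 : ℝ) : ℂ)) *
      ((hρ.eigenvectorUnitary : Matrix a a ℂ) ⊗ₖ (hσ.eigenvectorUnitary : Matrix b b ℂ))ᴴ := by
    conv_lhs => rw [eq_conj_diagonal_eigenvalues hρ, eq_conj_diagonal_eigenvalues hσ]
    rw [mul_kronecker_mul, mul_kronecker_mul, diagonal_kronecker_diagonal, conjTranspose_kronecker]
    simp
  rw [h, entropy_conj_diagonal, Fintype.sum_prod_type, entropy_eq_sum hρ, entropy_eq_sum hσ]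
  · simp only [Real.negMulLog_mul, Finset.sum_add_distrib, ← Finset.sum_mul, ← Finset.mul_sum,
      hr, hs, one_mul]
  · rw [conjTranspose_kronecker, ← mul_kronecker_mul, conjTranspose_eigenvectorUnitary_mul,
      conjTranspose_eigenvectorUnitary_mul, one_kronecker_one]

theorem eigenvalues_le_trace {ρ : Matrix a a ℂ} (hρ : ρ.PosSemidef) (i : a) :
    hρ.1.eigenvalues i ≤ ρ.trace.re := by
  rw [trace_re_eq_sum_eigenvalues hρ.1]
  exact Finset.single_le_sum (fun j _ => hρ.eigenvalues_nonneg j) (Finset.mem_univ i)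

theorem IsState.entropy_nonneg {ρ : Matrix a a ℂ} (hρ : IsState ρ) : 0 ≤ entropy ρ := by
  rw [entropy_eq_sum hρ.1.1]
  refine Finset.sum_nonneg fun i _ => Real.negMulLog_nonneg (hρ.1.eigenvalues_nonneg i) ?_
  simpa [hρ.2] using eigenvalues_le_trace hρ.1 i

/-- Klein's inequality: the entropy of `ρ` is at most its cross entropy with respect to `σ`. -/
theorem entropy_le_cross {ρ σ : Matrix a a ℂ} (hρ : ρ.PosSemidef) (hσ : σ.PosDef)
    (htr : ρ.trace = σ.trace) : entropy ρ ≤ -(ρ * cfc Real.log σ).trace.re := by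
  -- The scalar case, `log x ≤ x - 1` at `x = q / p`; it is then averaged with the doubly stochastic
  -- weights `overlap`, where equal traces make the right side vanish.
  have key : ∀ i j, hρ.1.eigenvalues i *
      (Real.log (hσ.1.eigenvalues j) - Real.log (hρ.1.eigenvalues i)) ≤
      hσ.1.eigenvalues j - hρ.1.eigenvalues i := by
    intro i j
    have hq := hσ.eigenvalues_pos j
    rcases (hρ.eigenvalues_nonneg i).eq_or_lt with h | h
    · rw [← h]; simpa using hq.le
    · rw [← Real.log_div hq.ne' h.ne']
      refine (mul_le_mul_of_nonneg_left (Real.log_le_sub_one_of_pos (div_pos hq h)) h.le).trans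
        (le_of_eq ?_)
      field_simp
  have hsum : ∑ j, ∑ i, overlap hρ.1 hσ.1 i j * (hρ.1.eigenvalues i *
      (Real.log (hσ.1.eigenvalues j) - Real.log (hρ.1.eigenvalues i))) ≤
      ∑ j, ∑ i, overlap hρ.1 hσ.1 i j * (hσ.1.eigenvalues j - hρ.1.eigenvalues i) :=
    Finset.sum_le_sum fun j _ => Finset.sum_le_sum fun i _ =>
      mul_le_mul_of_nonneg_left (key i j) (overlap_nonneg _ _ _ _)
  have hR : ∑ j, ∑ i, overlap hρ.1 hσ.1 i j * (hσ.1.eigenvalues j - hρ.1.eigenvalues i) = 0 := by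
    simp only [mul_sub, Finset.sum_sub_distrib]
    rw [Finset.sum_comm (f := fun j i => overlap hρ.1 hσ.1 i j * hρ.1.eigenvalues i)]
    simp only [← Finset.sum_mul, sum_overlap_left, sum_overlap_right, one_mul]
    rw [← trace_re_eq_sum_eigenvalues, ← trace_re_eq_sum_eigenvalues, htr, sub_self]
  have hL : ∑ j, ∑ i, overlap hρ.1 hσ.1 i j * (hρ.1.eigenvalues i *
      (Real.log (hσ.1.eigenvalues j) - Real.log (hρ.1.eigenvalues i))) =
      (ρ * cfc Real.log σ).trace.re + entropy ρ := by
    simp only [mul_sub, Finset.sum_sub_distrib]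
    rw [Finset.sum_comm (f := fun j i => overlap hρ.1 hσ.1 i j *
      (hρ.1.eigenvalues i * Real.log (hρ.1.eigenvalues i)))]
    simp only [← Finset.sum_mul, sum_overlap_right, one_mul]
    rw [entropy_eq_sum hρ.1, trace_mul_cfc hσ.1]
    simp only [eigenDiag_eq_sum hρ.1 hσ.1, Real.negMulLog, Finset.mul_sum, sub_eq_add_neg,
      ← Finset.sum_neg_distrib, neg_mul]
    congr 1
    exact Finset.sum_congr rfl fun j _ => Finset.sum_congr rfl fun i _ => by ring
  linarith

/-- Jensen's inequality for the concave `negMulLog` with uniform weights on the eigenvalues. -/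
theorem IsState.entropy_le_log_card {ρ : Matrix a a ℂ} (hρ : IsState ρ) :
    entropy ρ ≤ Real.log (Fintype.card a) := by
  have hs : ∑ i, hρ.1.1.eigenvalues i = 1 := by rw [← trace_re_eq_sum_eigenvalues, hρ.2]; rfl
  have hne : (Finset.univ : Finset a).Nonempty := by
    by_contra h
    rw [Finset.not_nonempty_iff_eq_empty] at h
    rw [h] at hs
    simp at hs
  have hc : (0 : ℝ) < Fintype.card a := by
    exact_mod_cast Finset.card_pos.2 hne
  have h := Real.concaveOn_negMulLog.le_map_sum (t := Finset.univ)
    (w := fun _ : a => (Fintype.card a : ℝ)⁻¹) (p := hρ.1.1.eigenvalues)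
    (fun _ _ => by positivity) (by simp [hc.ne']) (fun i _ => hρ.1.eigenvalues_nonneg i)
  simp only [smul_eq_mul, ← Finset.mul_sum, hs, mul_one, ← entropy_eq_sum hρ.1.1] at h
  rw [Real.negMulLog, Real.log_inv] at h
  have h2 := mul_le_mul_of_nonneg_left h hc.le
  field_simp at h2
  linarith

end Entropy


/-! ### Entropy of mixtures near a rank-deficient and near a faithful state. -/

section LogSingularity

open Matrix

variable {a b : Type*} [Fintype a] [DecidableEq a] [Fintype b] [DecidableEq b]

/-- A diagonal entry in any orthonormal basis is an average of the eigenvalues. -/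
theorem le_eigenDiag {X σ : Matrix a a ℂ} (hX : X.IsHermitian) (hσ : σ.IsHermitian) {c : ℝ}
    (hc : ∀ i, c ≤ hX.eigenvalues i) (j : a) : c ≤ eigenDiag hσ X j := by
  rw [eigenDiag_eq_sum hX hσ]
  calc c = ∑ i, c * overlap hX hσ i j := by rw [← Finset.mul_sum, sum_overlap_left, mul_one]
    _ ≤ _ := Finset.sum_le_sum fun i _ =>
      mul_le_mul_of_nonneg_right (hc i) (overlap_nonneg _ _ _ _)

theorem IsState.eigenDiag_le_one {X σ : Matrix a a ℂ} (hX : IsState X) (hσ : σ.IsHermitian)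
    (j : a) : eigenDiag hσ X j ≤ 1 := by
  have h := sum_eigenDiag hσ X
  rw [hX.2, Complex.one_re] at h
  rw [← h]
  exact Finset.single_le_sum (fun i _ => eigenDiag_nonneg hσ hX.1 i) (Finset.mem_univ j)

omit [DecidableEq a] in
theorem IsState.mix {X Y : Matrix a a ℂ} (hX : IsState X) (hY : IsState Y) {t : ℝ} (h0 : 0 ≤ t)
    (h1 : t ≤ 1) : IsState (((1 - t : ℝ) : ℂ) • X + (t : ℂ) • Y) := by
  refine ⟨(hX.1.smul ?_).add (hY.1.smul ?_), ?_⟩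
  · exact_mod_cast sub_nonneg.2 h1
  · exact_mod_cast h0
  · rw [trace_add, trace_smul, trace_smul, hX.2, hY.2]
    simp

theorem exists_eigenvalue_eq_zero {A : Matrix a a ℂ} (hA : A.IsHermitian)
    (h : A.rank < Fintype.card a) : ∃ i, hA.eigenvalues i = 0 := by
  by_contra! hne
  rw [hA.rank_eq_card_non_zero_eigs, Fintype.card_subtype] at h
  simp [hne] at h

/-- Mixing a rank-deficient state with a faithful one increases the entropy by an amount of order
`t log (1 / t)`. -/
theorem exists_entropy_mix_ge {A B : Matrix a a ℂ} (hA : IsState A)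
    (hAr : A.rank < Fintype.card a) (hB : B.PosDef) (hB1 : B.trace = 1) :
    ∃ c : ℝ, 0 < c ∧ ∀ t : ℝ, 0 < t → t < 1 →
      (1 - t) * entropy A - t * (c * Real.log t) ≤
        entropy (((1 - t : ℝ) : ℂ) • A + (t : ℂ) • B) := by
  obtain ⟨i₀, hi₀⟩ := exists_eigenvalue_eq_zero hA.1.1 hAr
  have : Nonempty a := ⟨i₀⟩
  obtain ⟨k, hk⟩ := Finite.exists_min hB.1.eigenvalues
  refine ⟨hB.1.eigenvalues k, hB.eigenvalues_pos k, fun t ht0 ht1 => ?_⟩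
  set c := hB.1.eigenvalues k
  have hBs : IsState B := ⟨hB.posSemidef, hB1⟩
  set M := ((1 - t : ℝ) : ℂ) • A + (t : ℂ) • B with hM
  have hMs : IsState M := hA.mix hBs ht0.le ht1.le
  have hMd : M.PosDef := by
    refine PosDef.posSemidef_add (hA.1.smul ?_) (hB.smul ?_)
    · exact_mod_cast (sub_pos.2 ht1).le
    · exact_mod_cast ht0
  have hsplit : entropy M = (1 - t) * -(A * cfc Real.log M).trace.re +
      t * -(B * cfc Real.log M).trace.re := by
    rw [entropy]
    -- Only the outer factor `M` is expanded; the `M` inside the logarithm stays.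
    conv_lhs => enter [1, 1, 1, 1]; rw [hM]
    rw [Matrix.add_mul, smul_mul, smul_mul, trace_add, trace_smul, trace_smul, smul_eq_mul,
      smul_eq_mul, Complex.add_re, Complex.re_ofReal_mul, Complex.re_ofReal_mul]
    ring
  have hKlein : entropy A ≤ -(A * cfc Real.log M).trace.re :=
    entropy_le_cross hA.1 hMd (by rw [hA.2, hMs.2])
  have hle1 : ∀ j, hMd.1.eigenvalues j ≤ 1 := fun j => by
    simpa [hMs.2] using eigenvalues_le_trace hMd.posSemidef j
  -- Along the kernel vector `i₀` of `A` the quadratic form of `M` is `t` times that of `B`, hence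
  -- at most `t`, so the least eigenvalue of `M` is too.
  obtain ⟨j₀, hj₀⟩ : ∃ j, hMd.1.eigenvalues j ≤ t := by
    by_contra! hgt
    obtain ⟨l, hl⟩ := Finite.exists_min hMd.1.eigenvalues
    have h1 := le_eigenDiag hMd.1 hA.1.1 hl i₀
    have h2 : eigenDiag hA.1.1 M i₀ ≤ t := by
      rw [hM, eigenDiag_add, eigenDiag_smul, eigenDiag_smul, eigenDiag_self, hi₀]
      nlinarith [hBs.eigenDiag_le_one hA.1.1 i₀]
    exact absurd (hgt l) (not_lt.2 (h1.trans h2))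
  -- All terms are nonnegative since the eigenvalues of `M` are at most one; the term at `j₀` alone
  -- suffices.
  have hcross : -(c * Real.log t) ≤ -(B * cfc Real.log M).trace.re := by
    rw [trace_mul_cfc hMd.1, ← Finset.sum_neg_distrib]
    have hnn : ∀ j, 0 ≤ -(Real.log (hMd.1.eigenvalues j) * eigenDiag hMd.1 B j) := fun j => by
      rw [← neg_mul]
      exact mul_nonneg (neg_nonneg.2 (Real.log_nonpos (hMd.eigenvalues_pos j).le (hle1 j)))
        (eigenDiag_nonneg _ hB.posSemidef j)
    refine le_trans ?_ (Finset.single_le_sum (fun j _ => hnn j) (Finset.mem_univ j₀))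
    have h1 := Real.log_le_log (hMd.eigenvalues_pos j₀) hj₀
    have h2 : c ≤ eigenDiag hMd.1 B j₀ := le_eigenDiag hB.1 hMd.1 hk j₀
    have h3 := Real.log_neg ht0 ht1
    have h4 : 0 < c := hB.eigenvalues_pos k
    nlinarith
  rw [hsplit]
  have h1 := mul_le_mul_of_nonneg_left hKlein (sub_pos.2 ht1).le
  have h2 := mul_le_mul_of_nonneg_left hcross ht0.le
  linarith

/-- Perturbing a faithful state changes the entropy at most linearly from above. -/
theorem entropy_mix_le {C D : Matrix b b ℂ} (hC : C.PosDef) (hC1 : C.trace = 1) (hD : IsState D)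
    {t : ℝ} (h0 : 0 ≤ t) (h1 : t ≤ 1) :
    entropy (((1 - t : ℝ) : ℂ) • C + (t : ℂ) • D) ≤
      (1 - t) * entropy C + t * -(D * cfc Real.log C).trace.re := by
  have hCs : IsState C := ⟨hC.posSemidef, hC1⟩
  have hs := hCs.mix hD h0 h1
  refine (entropy_le_cross hs.1 hC (by rw [hs.2, hC1])).trans (le_of_eq ?_)
  rw [Matrix.add_mul, smul_mul, smul_mul, trace_add, trace_smul, trace_smul, smul_eq_mul,
      smul_eq_mul, Complex.add_re, Complex.re_ofReal_mul, Complex.re_ofReal_mul, entropy]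
  ring

theorem exists_entropy_mix_lt {A B : Matrix a a ℂ} {C D : Matrix b b ℂ} (hA : IsState A)
    (hAr : A.rank < Fintype.card a) (hB : B.PosDef) (hB1 : B.trace = 1) (hC : C.PosDef)
    (hC1 : C.trace = 1) (hD : IsState D) (hS : entropy A = entropy C) :
    ∃ t : ℝ, 0 < t ∧ t < 1 ∧ entropy (((1 - t : ℝ) : ℂ) • C + (t : ℂ) • D) <
      entropy (((1 - t : ℝ) : ℂ) • A + (t : ℂ) • B) := by
  obtain ⟨c, hc, hlow⟩ := exists_entropy_mix_ge hA hAr hB hB1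
  set K := -(D * cfc Real.log C).trace.re
  -- The choice `t = exp (-(|K| + 1) / c)` makes the logarithmic gain `-c log t = |K| + 1` exceed
  -- the linear coefficient `K`.
  have hneg : -((|K| + 1) / c) < 0 := by
    have := abs_nonneg K
    exact neg_neg_of_pos (by positivity)
  have ht1 : Real.exp (-((|K| + 1) / c)) < 1 := by simpa using Real.exp_lt_exp.2 hneg
  refine ⟨_, Real.exp_pos (-((|K| + 1) / c)), ht1, ?_⟩
  have h1 := hlow _ (Real.exp_pos _) ht1
  have h2 := entropy_mix_le hC hC1 hD (Real.exp_pos _).le ht1.le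
  refine h2.trans_lt (lt_of_lt_of_le ?_ h1)
  rw [Real.log_exp, hS, mul_neg c, mul_div_cancel₀ _ hc.ne', mul_neg _ (|K| + 1), sub_neg_eq_add]
  change _ + _ * K < _
  have h3 := le_abs_self K
  have := mul_lt_mul_of_pos_left (lt_of_le_of_lt h3 (lt_add_one |K|))
    (Real.exp_pos (-((|K| + 1) / c)))
  linarith

end LogSingularity


/-! ### Complementary maps: minimal dimensions, pure inputs, compression, positivity. -/

section Complementary

open Matrix

variable {a b e : Type*} [Fintype a] [DecidableEq a] [Fintype b] [Fintype e]

/-- Complementarity in Kraus form: the blocks `K i` of the isometry are Kraus operators of `Φc`,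
and the entries of `Φ X` are the traces `Tr (K i X (K j)†)`. -/
theorem isComplementary_iff_kraus {Φ : MatMap a b} {Φc : MatMap a e} :
    IsComplementary Φ Φc ↔ ∃ K : b → Matrix e a ℂ, ∑ i, (K i)ᴴ * K i = 1 ∧
      ∀ X, (Φ X = of fun i j => (K i * X * (K j)ᴴ).trace) ∧ Φc X = ∑ i, K i * X * (K i)ᴴ := by
  have key : ∀ (V : Matrix (b × e) a ℂ) (X : Matrix a a ℂ) (i j : b) (k l : e), (V * X * Vᴴ) (i, k) (j, l) =
      ((of fun k p => V (i, k) p : Matrix e a ℂ) * X *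
        (of fun k p => V (j, k) p : Matrix e a ℂ)ᴴ) k l := by
    intro V X i j k l
    simp [mul_apply]
  have key₂ : ∀ V : Matrix (b × e) a ℂ, ∑ i, (of fun k p => V (i, k) p : Matrix e a ℂ)ᴴ *
      (of fun k p => V (i, k) p : Matrix e a ℂ) = Vᴴ * V := by
    intro V
    ext p q
    simp [mul_apply, Fintype.sum_prod_type, Matrix.sum_apply]
  constructor
  · rintro ⟨V, hV, h⟩
    refine ⟨fun i => of fun k p => V (i, k) p, (key₂ V).trans hV, fun X => ⟨?_, ?_⟩⟩
    · rw [(h X).1]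
      ext i j
      simp only [traceEnv, key, of_apply, trace, diag_apply]
    · rw [(h X).2]
      ext k l
      simp only [traceOut, key, of_apply, Matrix.sum_apply]
  · rintro ⟨K, hK, h⟩
    refine ⟨of fun x p => K x.1 x.2 p, (key₂ _).symm.trans hK, fun X => ⟨?_, ?_⟩⟩
    · rw [(h X).1]
      ext i j
      simp only [traceEnv, key, of_apply, trace, diag_apply]
      rfl
    · rw [(h X).2]
      ext k l
      simp only [traceOut, key, of_apply, Matrix.sum_apply]
      rfl

theorem IsComplementary.symm {Φ : MatMap a b} {Φc : MatMap a e} (h : IsComplementary Φ Φc) :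
    IsComplementary Φc Φ := by
  obtain ⟨V, hV, h⟩ := h
  have hs : ∀ X : Matrix a a ℂ, V.submatrix Prod.swap id * X * (V.submatrix Prod.swap id)ᴴ =
      (V * X * Vᴴ).submatrix (Prod.swap : e × b → b × e) Prod.swap := fun X => by
    ext x y; simp [mul_apply]
  refine ⟨V.submatrix Prod.swap id, ?_, fun X => ⟨?_, ?_⟩⟩
  · rw [← hV]
    ext p q
    simp only [mul_apply, conjTranspose_apply, submatrix_apply, id]
    exact (Equiv.prodComm e b).sum_comp fun x => star (V x p) * V x q
  · rw [hs, (h X).2]; rfl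
  · rw [hs, (h X).1]; rfl

theorem IsComplementary.isState_right {Φ : MatMap a b} {Φc : MatMap a e}
    (h : IsComplementary Φ Φc) {ρ : Matrix a a ℂ} (hρ : IsState ρ) : IsState (Φc ρ) := by
  obtain ⟨K, hK, h⟩ := isComplementary_iff_kraus.1 h
  rw [(h ρ).2]
  refine ⟨posSemidef_sum _ fun i _ => hρ.1.mul_mul_conjTranspose_same _, ?_⟩
  rw [trace_sum, ← hρ.2]
  rw [Finset.sum_congr rfl fun i _ => trace_mul_cycle (K i) ρ (K i)ᴴ,
    ← trace_sum, ← Finset.sum_mul, hK, Matrix.one_mul]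

theorem IsComplementary.isState_left {Φ : MatMap a b} {Φc : MatMap a e}
    (h : IsComplementary Φ Φc) {ρ : Matrix a a ℂ} (hρ : IsState ρ) : IsState (Φ ρ) :=
  h.symm.isState_right hρ

/-- A rearrangement of the Choi matrix of `Φ`. -/
noncomputable def choiMatrix (Φ : MatMap a b) : Matrix (b × a) (b × a) ℂ :=
  of fun x y => star (Φ (single x.2 y.2 1) x.1 y.1)

/-- With the Kraus operators stacked into one matrix `Y`, the two sides are the ranks of `Y Yᴴ` and
`Yᴴ Y`. Hence the rank of `Φc 1` depends on `Φ` only. -/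
theorem IsComplementary.rank_apply_one {Φ : MatMap a b} {Φc : MatMap a e}
    (h : IsComplementary Φ Φc) : (Φc 1).rank = (choiMatrix Φ).rank := by
  obtain ⟨K, -, h⟩ := isComplementary_iff_kraus.1 h
  let Y : Matrix e (b × a) ℂ := of fun k x => K x.1 k x.2
  have h₁ : Φc 1 = Y * Yᴴ := by
    rw [(h 1).2]
    ext k l
    simp [Y, mul_apply, Matrix.sum_apply, Fintype.sum_prod_type]
  have h₂ : choiMatrix Φ = Yᴴ * Y := by
    ext x y
    simp only [choiMatrix, of_apply, (h _).1, Y, trace, diag_apply, mul_apply, conjTranspose_apply,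
      star_sum, star_mul', single_apply]
    refine Finset.sum_congr rfl fun k _ => ?_
    rw [Finset.sum_eq_single y.2, Finset.sum_eq_single x.2]
    · simp
    · intro p _ hp; simp [hp.symm]
    · simp
    · intro q _ hq; simp [hq.symm]
    · simp
  rw [h₁, h₂, rank_self_mul_conjTranspose, rank_conjTranspose_mul_self]

/-- A positive semidefinite matrix of rank `r` is supported on the row space of some matrix with
`r` rows. -/
theorem exists_support {G : Matrix e e ℂ} (hG : G.IsHermitian) :
    ∃ W : Matrix (Fin G.rank) e ℂ, Wᴴ * W * G = G := by
  classical
  let U : Matrix e e ℂ := hG.eigenvectorUnitary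
  have hcard : Fintype.card {i // hG.eigenvalues i ≠ 0} = G.rank :=
    hG.rank_eq_card_non_zero_eigs.symm
  let f := Fintype.equivFinOfCardEq hcard
  -- The rows of `W` are the conjugated eigenvectors with nonzero eigenvalue, so `Wᴴ W` is the
  -- support projection.
  refine ⟨Uᴴ.submatrix (fun x => (f.symm x).1) id, ?_⟩
  have hP : (Uᴴ.submatrix (fun x => (f.symm x).1) id)ᴴ * Uᴴ.submatrix (fun x => (f.symm x).1) id =
      U * diagonal (fun i => if hG.eigenvalues i ≠ 0 then (1 : ℂ) else 0) * Uᴴ := by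
    ext k l
    simp only [mul_apply (M := (_ : Matrix e (Fin G.rank) ℂ)), mul_apply (M := U * _),
      mul_diagonal, conjTranspose_apply, submatrix_apply, id, star_star]
    rw [f.symm.sum_comp (fun x => U k x.1 * star (U l x.1))]
    simp only [mul_ite, mul_one, mul_zero, ite_mul, zero_mul]
    rw [← Finset.sum_filter, Finset.sum_subtype (Finset.univ.filter fun i => hG.eigenvalues i ≠ 0)
      (p := fun i => hG.eigenvalues i ≠ 0) (by simp)]
  have hGU : G = U * diagonal (fun i => ((hG.eigenvalues i : ℝ) : ℂ)) * Uᴴ :=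
    eq_conj_diagonal_eigenvalues hG
  have hUU : Uᴴ * U = 1 := conjTranspose_eigenvectorUnitary_mul hG
  rw [hP]
  conv_rhs => rw [hGU]
  rw [show ∀ T : Matrix e e ℂ, T * G = T * _ from fun T => congrArg (T * ·) hGU]
  simp only [Matrix.mul_assoc]
  rw [← Matrix.mul_assoc Uᴴ U, hUU, Matrix.one_mul, ← Matrix.mul_assoc (diagonal _) (diagonal _),
    diagonal_mul_diagonal]
  congr 3
  ext i
  by_cases hi : hG.eigenvalues i = 0 <;> simp [hi]

omit [DecidableEq a] in
-- Conjugating the sum by `1 - P` gives a vanishing sum of positive semidefinite matrices, so each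
-- one vanishes.
theorem mul_eq_self_of_mul_sum {ι : Type*} [Fintype ι] [DecidableEq e] (K : ι → Matrix e a ℂ)
    {P : Matrix e e ℂ} (h : P * ∑ i, K i * (K i)ᴴ = ∑ i, K i * (K i)ᴴ) (i : ι) :
    P * K i = K i := by
  have h0 : ∑ i, (((1 - P) * K i) * ((1 - P) * K i)ᴴ) = 0 := by
    have : ∀ i, ((1 - P) * K i) * ((1 - P) * K i)ᴴ = (1 - P) * (K i * (K i)ᴴ) * (1 - P)ᴴ :=
      fun i => by simp only [conjTranspose_mul, Matrix.mul_assoc]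
    simp only [this]
    rw [← Finset.sum_mul, ← Finset.mul_sum, Matrix.sub_mul, h, Matrix.one_mul, sub_self,
      Matrix.zero_mul]
  have h1 := congrArg trace h0
  rw [trace_sum, trace_zero, Finset.sum_eq_zero_iff_of_nonneg fun j _ =>
    (posSemidef_self_mul_conjTranspose _).trace_nonneg] at h1
  have h2 := trace_mul_conjTranspose_self_eq_zero_iff.1 (h1 i (Finset.mem_univ i))
  rw [Matrix.sub_mul, Matrix.one_mul, sub_eq_zero] at h2
  exact h2.symm

/-- The environment of a complementary pair can be compressed to the support of `Φc 1`. -/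
theorem IsComplementary.exists_compression {Φ : MatMap a b} {Φc : MatMap a e}
    (h : IsComplementary Φ Φc) : ∃ W : Matrix (Fin (Φc 1).rank) e ℂ,
      (∀ X, Wᴴ * W * Φc X = Φc X) ∧
      ∃ Φc' : MatMap a (Fin (Φc 1).rank), IsComplementary Φ Φc' := by
  classical
  obtain ⟨K, hK, h⟩ := isComplementary_iff_kraus.1 h
  have h1 : Φc 1 = ∑ i, K i * (K i)ᴴ := by simpa using (h 1).2
  have hherm : (Φc 1).IsHermitian := by
    rw [h1]
    exact (posSemidef_sum _ fun i _ => posSemidef_self_mul_conjTranspose _).1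
  obtain ⟨W, hW⟩ := exists_support hherm
  have hWK : ∀ i, Wᴴ * W * K i = K i := by
    refine mul_eq_self_of_mul_sum K ?_
    rw [← h1, hW]
  refine ⟨W, fun X => ?_, LinearMap.comp
    { toFun := fun Z : Matrix e e ℂ => W * Z * Wᴴ
      map_add' := fun Y Z : Matrix e e ℂ => by rw [Matrix.mul_add, Matrix.add_mul]
      map_smul' := fun (c : ℂ) (Z : Matrix e e ℂ) => by simp } Φc,
    isComplementary_iff_kraus.2 ⟨fun i => W * K i, ?_, fun X => ⟨?_, ?_⟩⟩⟩
  · rw [(h X).2, Finset.mul_sum]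
    refine Finset.sum_congr rfl fun i _ => ?_
    rw [← Matrix.mul_assoc, ← Matrix.mul_assoc, hWK]
  · refine (Finset.sum_congr rfl fun i _ => ?_).trans hK
    rw [conjTranspose_mul, Matrix.mul_assoc, ← Matrix.mul_assoc Wᴴ, hWK]
  · rw [(h X).1]
    ext i j
    change _ = (W * K i * X * (W * K j)ᴴ).trace
    rw [of_apply, conjTranspose_mul, ← Matrix.mul_assoc, trace_mul_comm _ Wᴴ]
    simp only [← Matrix.mul_assoc]
    rw [hWK]
  · change W * Φc X * Wᴴ = ∑ i, W * K i * X * (W * K i)ᴴ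
    rw [(h X).2, Matrix.mul_sum, Matrix.sum_mul]
    refine Finset.sum_congr rfl fun i _ => ?_
    simp only [conjTranspose_mul, Matrix.mul_assoc]

/-- Compression attains the rank. Any competitor has the same rank at the identity by
`rank_apply_one`, and it cannot exceed the competitor's dimension. -/
theorem IsComplementary.minEnvDim_eq {Φ : MatMap a b} {Φc : MatMap a e}
    (h : IsComplementary Φ Φc) : minEnvDim Φ = (Φc 1).rank := by
  obtain ⟨-, -, hc⟩ := h.exists_compression
  refine le_antisymm (Nat.sInf_le hc) (le_csInf ⟨_, hc⟩ ?_)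
  rintro n ⟨Φ', h'⟩
  rw [h.rank_apply_one, ← h'.rank_apply_one]
  simpa using (Φ' 1).rank_le_card_width

theorem minOutDim_eq {Φ : MatMap a b} {n : ℕ} {Φc : MatMap a (Fin n)}
    (h : IsComplementary Φ Φc) : minOutDim Φ = (Φ 1).rank := by
  have : {m : ℕ | ∃ (e : ℕ) (Φc : MatMap a (Fin e)), IsComplementary Φ Φc ∧ m = minEnvDim Φc} =
      {(Φ 1).rank} := by
    ext m
    constructor
    · rintro ⟨k, Φ', h', rfl⟩
      exact h'.symm.minEnvDim_eq
    · rintro rfl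
      exact ⟨n, Φc, h, h.symm.minEnvDim_eq.symm⟩
  rw [minOutDim, this, csInf_singleton]

/-- `N` is the coefficient matrix of the bipartite vector `V ψ`, with columns `K i ψ`; this is the
Schmidt decomposition in matrix form. -/
theorem IsComplementary.exists_pure {Φ : MatMap a b} {Φc : MatMap a e}
    (h : IsComplementary Φ Φc) {P : Matrix a a ℂ} (hP : IsPureState P) :
    ∃ N : Matrix e b ℂ, Φc P = N * Nᴴ ∧ Φ P = (Nᴴ * N)ᵀ := by
  obtain ⟨K, -, h⟩ := isComplementary_iff_kraus.1 h
  obtain ⟨ψ, -, rfl⟩ := hP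
  have hKψ : ∀ i j, K i * vecMulVec ψ (star ψ) * (K j)ᴴ =
      vecMulVec (K i *ᵥ ψ) (star (K j *ᵥ ψ)) := fun i j => by
    rw [mul_vecMulVec, vecMulVec_mul, star_mulVec]
  refine ⟨of fun k i => (K i *ᵥ ψ) k, ?_, ?_⟩
  · rw [(h _).2]
    ext k l
    simp [hKψ, mul_apply, Matrix.sum_apply, vecMulVec_apply]
  · rw [(h _).1]
    ext i j
    simp [hKψ, mul_apply, trace, vecMulVec_apply, mul_comm]

omit [DecidableEq a] in
theorem IsPureState.isState {P : Matrix a a ℂ} (hP : IsPureState P) : IsState P := by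
  obtain ⟨ψ, h1, rfl⟩ := hP
  exact ⟨posSemidef_vecMulVec_self_star ψ, by rw [trace_vecMulVec, dotProduct_comm, h1]⟩

theorem IsComplementary.rank_pure {Φ : MatMap a b} {Φc : MatMap a e}
    (h : IsComplementary Φ Φc) {P : Matrix a a ℂ} (hP : IsPureState P) :
    (Φ P).rank = (Φc P).rank := by
  obtain ⟨N, h₁, h₂⟩ := h.exists_pure hP
  rw [h₁, h₂, rank_transpose, rank_self_mul_conjTranspose, rank_conjTranspose_mul_self]

theorem IsComplementary.entropy_pure [DecidableEq b] [DecidableEq e] {Φ : MatMap a b}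
    {Φc : MatMap a e} (h : IsComplementary Φ Φc) {P : Matrix a a ℂ} (hP : IsPureState P) :
    entropy (Φ P) = entropy (Φc P) := by
  obtain ⟨N, h₁, h₂⟩ := h.exists_pure hP
  rw [h₁, h₂, entropy_transpose (isHermitian_conjTranspose_mul_self N)]
  exact entropy_mul_comm _ _ (isHermitian_conjTranspose_mul_self N)
    (isHermitian_mul_conjTranspose_self N)

/-- Cycling `W` gives `Wᴴ W X = X`, and `entropy_mul_comm` ignores the change of size. -/
theorem entropy_compress [DecidableEq b] [DecidableEq e] {W : Matrix b e ℂ} {X : Matrix e e ℂ}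
    (hX : X.IsHermitian) (hW : Wᴴ * W * X = X) : entropy (W * X * Wᴴ) = entropy X := by
  have h : Wᴴ * (W * X) = X := by rw [← Matrix.mul_assoc, hW]
  rw [entropy_mul_comm, h]
  · exact isHermitian_mul_mul_conjTranspose _ hX
  · rwa [h]

theorem rank_compress [DecidableEq e] {W : Matrix b e ℂ} {X : Matrix e e ℂ}
    (hX : X.IsHermitian) (hW : Wᴴ * W * X = X) : (W * X * Wᴴ).rank = X.rank := by
  have hW' : X * (Wᴴ * W) = X := by
    have := congrArg conjTranspose hW
    simpa [hX.eq] using this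
  refine le_antisymm ((rank_mul_le_left _ _).trans (rank_mul_le_right _ _)) ?_
  have h : X = Wᴴ * (W * X * Wᴴ) * W := by
    calc X = Wᴴ * W * X * (Wᴴ * W) := by rw [hW, hW']
      _ = _ := by simp only [Matrix.mul_assoc]
  calc X.rank = (Wᴴ * (W * X * Wᴴ) * W).rank := by rw [← h]
    _ ≤ _ := (rank_mul_le_left _ _).trans (rank_mul_le_right _ _)

theorem IsState.compress {W : Matrix b e ℂ} {X : Matrix e e ℂ} (hX : IsState X)
    (hW : Wᴴ * W * X = X) : IsState (W * X * Wᴴ) :=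
  ⟨hX.1.mul_mul_conjTranspose_same W, by rw [trace_mul_cycle, hW, hX.2]⟩

theorem posDef_of_rank_eq [DecidableEq b] {X : Matrix b b ℂ} (hX : X.PosSemidef)
    (h : X.rank = Fintype.card b) : X.PosDef := by
  rw [hX.1.posDef_iff_eigenvalues_pos]
  intro i
  refine (hX.eigenvalues_nonneg i).lt_of_ne fun h0 => ?_
  rw [hX.1.rank_eq_card_non_zero_eigs] at h
  exact (Fintype.card_subtype_lt (x := i) (by simpa using h0.symm)).ne h

theorem isState_maximallyMixed [Nonempty a] :
    IsState (((Fintype.card a : ℂ)⁻¹) • (1 : Matrix a a ℂ)) := by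
  refine ⟨PosSemidef.one.smul ?_, ?_⟩
  · rw [inv_nonneg]; exact_mod_cast Nat.zero_le _
  · simp

theorem rank_smul_of_ne_zero {c : ℂ} (hc : c ≠ 0) (X : Matrix b b ℂ) : (c • X).rank = X.rank := by
  classical
  refine le_antisymm ?_ ?_
  · rw [show c • X = (c • (1 : Matrix b b ℂ)) * X by simp]
    exact rank_mul_le_right _ _
  · conv_lhs => rw [show X = (c⁻¹ • (1 : Matrix b b ℂ)) * (c • X) by simp [smul_smul, hc]]
    exact rank_mul_le_right _ _

omit [Fintype a] [DecidableEq a] [Fintype b] in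
theorem mix_compress (W : Matrix b e ℂ) (Ψ : MatMap a e) (X Y : Matrix a a ℂ) (s t : ℂ) :
    s • (W * Ψ X * Wᴴ) + t • (W * Ψ Y * Wᴴ) = W * Ψ (s • X + t • Y) * Wᴴ := by
  simp [Matrix.mul_add, Matrix.add_mul]

/-- The witness mixes `P` with the maximally mixed state. Compression to the supports of `Φ 1` and
`Φc 1` makes `Φ τ` and `Φc P` faithful and leaves `Φ P` singular, as `exists_entropy_mix_lt`
requires. -/
theorem IsComplementary.exists_coherentInfoAt_pos [DecidableEq b] [DecidableEq e]
    {Φ : MatMap a b} {Φc : MatMap a e} (h : IsComplementary Φ Φc) {P : Matrix a a ℂ}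
    (hP : IsPureState P) (hrank : (Φ P).rank = (Φc 1).rank) (hlt : (Φc 1).rank < (Φ 1).rank) :
    ∃ ρ, IsState ρ ∧ 0 < coherentInfoAt Φ Φc ρ := by
  have hPs := hP.isState
  have : Nonempty a := by
    by_contra hne
    rw [not_nonempty_iff] at hne
    simpa [trace] using hPs.2
  obtain ⟨W, hW, -⟩ := h.symm.exists_compression
  obtain ⟨Wc, hWc, -⟩ := h.exists_compression
  have hc : ((Fintype.card a : ℂ)⁻¹) ≠ 0 := by simp
  set τ : Matrix a a ℂ := ((Fintype.card a : ℂ)⁻¹) • 1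
  have hτ : IsState τ := isState_maximallyMixed
  have hB := (h.isState_left hτ).compress (hW τ)
  have hC := (h.isState_right hPs).compress (hWc P)
  have hBd : (W * Φ τ * Wᴴ).PosDef := by
    refine posDef_of_rank_eq hB.1 ?_
    rw [rank_compress (h.isState_left hτ).1.1 (hW τ), map_smul, rank_smul_of_ne_zero hc,
      Fintype.card_fin]
  -- The rank hypothesis enters here: `Φc P` has the rank of `Φ P`, which fills the minimal
  -- environment.
  have hCd : (Wc * Φc P * Wcᴴ).PosDef := by
    refine posDef_of_rank_eq hC.1 ?_
    rw [rank_compress (h.isState_right hPs).1.1 (hWc P), ← h.rank_pure hP, hrank,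
      Fintype.card_fin]
  obtain ⟨t, ht0, ht1, ht⟩ := exists_entropy_mix_lt ((h.isState_left hPs).compress (hW P))
    (by rwa [rank_compress (h.isState_left hPs).1.1 (hW P), hrank, Fintype.card_fin]) hBd hB.2
    hCd hC.2 ((h.isState_right hτ).compress (hWc τ))
    (by rw [entropy_compress (h.isState_left hPs).1.1 (hW P),
      entropy_compress (h.isState_right hPs).1.1 (hWc P), h.entropy_pure hP])
  have hs := hPs.mix hτ ht0.le ht1.le
  refine ⟨_, hs, ?_⟩
  rw [mix_compress, mix_compress, entropy_compress (h.isState_left hs).1.1 (hW _),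
    entropy_compress (h.isState_right hs).1.1 (hWc _)] at ht
  exact sub_pos.2 ht

end Complementary


/-! ### Relabellings, products and tensor powers of complementary pairs. -/

section TensorProducts

open Matrix Kronecker

variable {a b e a' b' e' : Type*} [Fintype a] [DecidableEq a] [Fintype b] [Fintype e]
  [Fintype a'] [DecidableEq a'] [Fintype b'] [Fintype e']

omit [Fintype b] in
theorem apply_eq_sum_single (Φ : MatMap a b) (X : Matrix a a ℂ) (i j : b) :
    Φ X i j = ∑ k, ∑ l, X k l * Φ (single k l 1) i j := by
  conv_lhs => rw [matrix_eq_sum_single X]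
  simp only [map_sum, Matrix.sum_apply]
  refine Finset.sum_congr rfl fun k _ => Finset.sum_congr rfl fun l _ => ?_
  have : single k l (X k l) = X k l • single k l (1 : ℂ) := by simp
  rw [this, map_smul, Matrix.smul_apply, smul_eq_mul]

omit [Fintype b] in
theorem matMap_ext {Φ Ψ : MatMap a b} (h : ∀ k l i j, Φ (single k l 1) i j = Ψ (single k l 1) i j) :
    Φ = Ψ := by
  ext X i j
  rw [apply_eq_sum_single, apply_eq_sum_single]
  simp only [h]

/-- Complementarity only has to be checked on matrix units. -/
theorem isComplementary_iff_single {Φ : MatMap a b} {Φc : MatMap a e} :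
    IsComplementary Φ Φc ↔ ∃ V : Matrix (b × e) a ℂ, Vᴴ * V = 1 ∧ ∀ k l,
      (∀ i j, Φ (single k l 1) i j = ∑ c, V (i, c) k * star (V (j, c) l)) ∧
      (∀ c d, Φc (single k l 1) c d = ∑ i, V (i, c) k * star (V (i, d) l)) := by
  have key : ∀ (V : Matrix (b × e) a ℂ) k l x y,
      (V * single k l (1 : ℂ) * Vᴴ) x y = V x k * star (V y l) := by
    intro V k l x y
    rw [mul_apply, Finset.sum_eq_single l]
    · simp
    · intro q _ hq; simp [mul_single_apply_of_ne _ _ _ _ _ hq]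
    · simp
  constructor
  · rintro ⟨V, hV, h⟩
    refine ⟨V, hV, fun k l => ⟨fun i j => ?_, fun c d => ?_⟩⟩
    · rw [(h _).1]; simp only [traceEnv, of_apply, key]
    · rw [(h _).2]; simp only [traceOut, of_apply, key]
  · rintro ⟨V, hV, h⟩
    have h₁ : Φ = { toFun := fun X : Matrix a a ℂ => traceEnv (V * X * Vᴴ)
                    map_add' := fun X Y : Matrix a a ℂ => by
                      ext; simp [traceEnv, Matrix.mul_add, Matrix.add_mul, Finset.sum_add_distrib]
                    map_smul' := fun (c : ℂ) (X : Matrix a a ℂ) => by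
                      ext; simp [traceEnv, Finset.mul_sum] } := by
      refine matMap_ext fun k l i j => ?_
      rw [(h k l).1]
      simp only [LinearMap.coe_mk, AddHom.coe_mk, traceEnv, of_apply, key]
    have h₂ : Φc = { toFun := fun X : Matrix a a ℂ => traceOut (V * X * Vᴴ)
                     map_add' := fun X Y : Matrix a a ℂ => by
                      ext; simp [traceOut, Matrix.mul_add, Matrix.add_mul, Finset.sum_add_distrib]
                     map_smul' := fun (c : ℂ) (X : Matrix a a ℂ) => by
                      ext; simp [traceOut, Finset.mul_sum] } := by
      refine matMap_ext fun k l i j => ?_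
      rw [(h k l).2]
      simp only [LinearMap.coe_mk, AddHom.coe_mk, traceOut, of_apply, key]
    exact ⟨V, hV, fun X => ⟨by rw [h₁]; rfl, by rw [h₂]; rfl⟩⟩

/-- Relabelling the bases of the input and output spaces. -/
noncomputable def reindexMap (f : a' ≃ a) (g : b' ≃ b) (Φ : MatMap a b) : MatMap a' b' where
  toFun X := (Φ (X.submatrix f.symm f.symm)).submatrix g g
  map_add' X Y := by
    rw [submatrix_add]; simp only [Pi.add_apply, map_add]; rfl
  map_smul' c X := by
    rw [submatrix_smul]; simp only [Pi.smul_apply, map_smul]; rfl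

omit [Fintype a] [Fintype b] [Fintype a'] [Fintype b'] in
theorem reindexMap_single (f : a' ≃ a) (g : b' ≃ b) (Φ : MatMap a b) (k l : a') (i j : b') :
    reindexMap f g Φ (single k l 1) i j = Φ (single (f k) (f l) 1) (g i) (g j) := by
  have : (single k l (1 : ℂ)).submatrix f.symm f.symm = single (f k) (f l) 1 := by
    ext x y
    simp [single_apply, Equiv.eq_symm_apply]
  change Φ ((single k l (1 : ℂ)).submatrix f.symm f.symm) (g i) (g j) = _
  rw [this]

omit [Fintype a] [DecidableEq a] [Fintype b] [Fintype a'] [DecidableEq a'] [Fintype b'] in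
theorem reindexMap_submatrix (f : a' ≃ a) (g : b' ≃ b) (Φ : MatMap a b) (X : Matrix a a ℂ) :
    reindexMap f g Φ (X.submatrix f f) = (Φ X).submatrix g g := by
  change (Φ ((X.submatrix f f).submatrix f.symm f.symm)).submatrix g g = _
  simp

theorem IsComplementary.reindex {Φ : MatMap a b} {Φc : MatMap a e} (h : IsComplementary Φ Φc)
    (f : a' ≃ a) (g : b' ≃ b) (r : e' ≃ e) :
    IsComplementary (reindexMap f g Φ) (reindexMap f r Φc) := by
  obtain ⟨V, hV, h⟩ := isComplementary_iff_single.1 h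
  refine isComplementary_iff_single.2 ⟨V.submatrix (g.prodCongr r) f, ?_, fun k l =>
    ⟨fun i j => ?_, fun c d => ?_⟩⟩
  · rw [conjTranspose_submatrix, submatrix_mul_equiv, hV, submatrix_one_equiv]
  · rw [reindexMap_single, (h _ _).1]
    exact (r.sum_comp fun c => V (g i, c) (f k) * star (V (g j, c) (f l))).symm
  · rw [reindexMap_single, (h _ _).2]
    exact (g.sum_comp fun i => V (i, r c) (f k) * star (V (i, r d) (f l))).symm

omit [DecidableEq a] [DecidableEq a'] in
theorem IsState.submatrix {ρ : Matrix a a ℂ} (hρ : IsState ρ) (f : a' ≃ a) :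
    IsState (ρ.submatrix f f) :=
  ⟨hρ.1.submatrix f, by rw [← hρ.2]; exact f.sum_comp fun i => ρ i i⟩

/-- The tensor product of two maps. -/
noncomputable def prodMap (Φ : MatMap a b) (Ψ : MatMap a' b') : MatMap (a × a') (b × b') where
  toFun X := of fun i j =>
    ∑ k, ∑ l, X k l * (Φ (single k.1 l.1 1) i.1 j.1 * Ψ (single k.2 l.2 1) i.2 j.2)
  map_add' X Y := by
    ext i j
    simp [add_mul, Finset.sum_add_distrib]
  map_smul' c X := by
    ext i j
    simp [mul_assoc, Finset.mul_sum]

omit [Fintype b] [Fintype b'] in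
theorem prodMap_single (Φ : MatMap a b) (Ψ : MatMap a' b') (k l : a × a') (i j : b × b') :
    prodMap Φ Ψ (single k l 1) i j =
      Φ (single k.1 l.1 1) i.1 j.1 * Ψ (single k.2 l.2 1) i.2 j.2 := by
  change ∑ p, ∑ q, (single k l 1 : Matrix _ _ ℂ) p q * _ = _
  rw [Finset.sum_eq_single k, Finset.sum_eq_single l]
  · simp
  · intro q _ hq; simp [hq.symm]
  · simp
  · intro p _ hp; simp [hp.symm]
  · simp

omit [Fintype b] [Fintype b'] in
theorem prodMap_kronecker (Φ : MatMap a b) (Ψ : MatMap a' b') (X : Matrix a a ℂ)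
    (Y : Matrix a' a' ℂ) : prodMap Φ Ψ (X ⊗ₖ Y) = Φ X ⊗ₖ Ψ Y := by
  ext i j
  rw [kronecker_apply, apply_eq_sum_single Φ X, apply_eq_sum_single Ψ Y, Finset.sum_mul_sum]
  change ∑ p, ∑ q, (X ⊗ₖ Y) p q * _ = _
  simp only [kronecker_apply, Fintype.sum_prod_type, Finset.sum_mul_sum]
  refine Finset.sum_congr rfl fun k _ => Finset.sum_congr rfl fun k' _ =>
    Finset.sum_congr rfl fun l _ => Finset.sum_congr rfl fun l' _ => by ring

theorem IsComplementary.prod {Φ : MatMap a b} {Φc : MatMap a e} {Ψ : MatMap a' b'}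
    {Ψc : MatMap a' e'} (h : IsComplementary Φ Φc) (h' : IsComplementary Ψ Ψc) :
    IsComplementary (prodMap Φ Ψ) (prodMap Φc Ψc) := by
  obtain ⟨V, hV, h⟩ := isComplementary_iff_single.1 h
  obtain ⟨V', hV', h'⟩ := isComplementary_iff_single.1 h'
  refine isComplementary_iff_single.2 ⟨(V ⊗ₖ V').submatrix (Equiv.prodProdProdComm b b' e e')
    (Equiv.refl _), ?_, fun k l => ⟨fun i j => ?_, fun c d => ?_⟩⟩
  · rw [conjTranspose_submatrix, submatrix_mul_equiv, conjTranspose_kronecker, ← mul_kronecker_mul,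
      hV, hV', one_kronecker_one, submatrix_one_equiv]
  · rw [prodMap_single, (h _ _).1, (h' _ _).1, Finset.sum_mul_sum, Fintype.sum_prod_type]
    refine Finset.sum_congr rfl fun c _ => Finset.sum_congr rfl fun c' _ => ?_
    simp
    ring
  · rw [prodMap_single, (h _ _).2, (h' _ _).2, Finset.sum_mul_sum, Fintype.sum_prod_type]
    refine Finset.sum_congr rfl fun c _ => Finset.sum_congr rfl fun c' _ => ?_
    simp
    ring

omit [DecidableEq a] [DecidableEq a'] in
theorem IsState.kronecker {ρ : Matrix a a ℂ} {σ : Matrix a' a' ℂ} (hρ : IsState ρ)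
    (hσ : IsState σ) : IsState (ρ ⊗ₖ σ) :=
  ⟨hρ.1.kronecker hσ.1, by rw [trace_kronecker, hρ.2, hσ.2, one_mul]⟩

omit [Fintype b] in
theorem tensorPower_single (Φ : MatMap a b) (n : ℕ) (k l : Fin n → a) (i j : Fin n → b) :
    tensorPower Φ n (single k l 1) i j = ∏ t, Φ (single (k t) (l t) 1) (i t) (j t) := by
  change ∑ p, ∑ q, (single k l 1 : Matrix _ _ ℂ) p q * _ = _
  rw [Finset.sum_eq_single k, Finset.sum_eq_single l]
  · simp
  · intro q _ hq; simp [hq.symm]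
  · simp
  · intro p _ hp; simp [hp.symm]
  · simp

omit [Fintype b] in
-- This reduces superadditivity over tensor powers to products of two maps.
theorem tensorPower_add (Φ : MatMap a b) (m n : ℕ) :
    tensorPower Φ (m + n) = reindexMap (Fin.appendEquiv m n).symm (Fin.appendEquiv m n).symm
      (prodMap (tensorPower Φ m) (tensorPower Φ n)) := by
  refine matMap_ext fun k l i j => ?_
  rw [reindexMap_single, prodMap_single, tensorPower_single, tensorPower_single,
    tensorPower_single, Fin.prod_univ_add]
  rfl

omit [Fintype b] in
theorem tensorPower_one (Φ : MatMap a b) :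
    tensorPower Φ 1 = reindexMap (Equiv.funUnique (Fin 1) a) (Equiv.funUnique (Fin 1) b) Φ := by
  refine matMap_ext fun k l i j => ?_
  rw [reindexMap_single, tensorPower_single]
  simp

end TensorProducts

/-! ### Superadditivity of the coherent information and its regularization. -/

section Capacity

open Matrix Kronecker

variable {a b e a' b' e' : Type*} [Fintype a] [DecidableEq a] [Fintype b] [DecidableEq b]
  [Fintype e] [DecidableEq e] [Fintype a'] [DecidableEq a'] [Fintype b'] [DecidableEq b']

theorem IsComplementary.coherentInfoAt_le {Φ : MatMap a b} {Φc : MatMap a e}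
    (h : IsComplementary Φ Φc) {ρ : Matrix a a ℂ} (hρ : IsState ρ) :
    coherentInfoAt Φ Φc ρ ≤ Real.log (Fintype.card b) := by
  have h₁ := (h.isState_left hρ).entropy_le_log_card
  have h₂ := (h.isState_right hρ).entropy_nonneg
  rw [coherentInfoAt]
  linarith

theorem IsComplementary.coherentInfoAt_le_coherentInfo {Φ : MatMap a b} {Φc : MatMap a e}
    (h : IsComplementary Φ Φc) {ρ : Matrix a a ℂ} (hρ : IsState ρ) :
    coherentInfoAt Φ Φc ρ ≤ coherentInfo Φ := by
  have hr := h.reindex (Equiv.refl a) (Equiv.refl b) (Fintype.equivFin e).symm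
  -- A real `sSup` dominates its members only for a bounded set; the bound comes from the output
  -- dimension and does not involve the environment.
  have hbdd : BddAbove {x : ℝ | ∃ (e : ℕ) (Φc : MatMap a (Fin e)) (ρ : Matrix a a ℂ),
      IsComplementary Φ Φc ∧ IsState ρ ∧ x = coherentInfoAt Φ Φc ρ} := by
    refine ⟨Real.log (Fintype.card b), ?_⟩
    rintro x ⟨n, Φ', σ, h', hσ, rfl⟩
    exact h'.coherentInfoAt_le hσ
  refine le_csSup hbdd ⟨_, _, ρ, hr, hρ, ?_⟩
  rw [coherentInfoAt, coherentInfoAt]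
  congr 1
  exact (entropy_submatrix (h.isState_right hρ).1.1 _).symm

theorem coherentInfo_le [Nonempty a] {Φ : MatMap a b}
    (hΦ : ∃ (n : ℕ) (Φc : MatMap a (Fin n)), IsComplementary Φ Φc) {x : ℝ}
    (hx : ∀ (n : ℕ) (Φc : MatMap a (Fin n)) (ρ : Matrix a a ℂ), IsComplementary Φ Φc → IsState ρ →
      coherentInfoAt Φ Φc ρ ≤ x) : coherentInfo Φ ≤ x := by
  obtain ⟨n, Φc, h⟩ := hΦ
  refine csSup_le ⟨_, n, Φc, _, h, isState_maximallyMixed, rfl⟩ ?_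
  rintro y ⟨m, Φ', ρ, h', hρ, rfl⟩
  exact hx m Φ' ρ h' hρ

theorem coherentInfo_le_reindexMap [Nonempty a] {Φ : MatMap a b}
    (hΦ : ∃ (n : ℕ) (Φc : MatMap a (Fin n)), IsComplementary Φ Φc) (f : a' ≃ a) (g : b' ≃ b) :
    coherentInfo Φ ≤ coherentInfo (reindexMap f g Φ) := by
  refine coherentInfo_le hΦ fun n Φc ρ h hρ => ?_
  refine le_trans (le_of_eq ?_) ((h.reindex f g (Equiv.refl _)).coherentInfoAt_le_coherentInfo
    (hρ.submatrix f))
  rw [coherentInfoAt, coherentInfoAt, reindexMap_submatrix, reindexMap_submatrix,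
    entropy_submatrix (h.isState_left hρ).1.1, entropy_submatrix (h.isState_right hρ).1.1]

/-- Test the product map on `ρ ⊗ₖ σ`: both output and environment entropies add. The two suprema are
removed one at a time by moving the other term across the inequality. -/
theorem coherentInfo_add_le_prodMap [Nonempty a] [Nonempty a'] {Φ : MatMap a b} {Ψ : MatMap a' b'}
    (hΦ : ∃ (n : ℕ) (Φc : MatMap a (Fin n)), IsComplementary Φ Φc)
    (hΨ : ∃ (n : ℕ) (Ψc : MatMap a' (Fin n)), IsComplementary Ψ Ψc) :
    coherentInfo Φ + coherentInfo Ψ ≤ coherentInfo (prodMap Φ Ψ) := by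
  rw [← le_sub_iff_add_le]
  refine coherentInfo_le hΦ fun n Φc ρ h hρ => ?_
  rw [le_sub_comm]
  refine coherentInfo_le hΨ fun m Ψc σ h' hσ => ?_
  rw [le_sub_iff_add_le']
  refine le_trans (le_of_eq ?_)
    ((h.prod h').coherentInfoAt_le_coherentInfo (hρ.kronecker hσ))
  have l := h.isState_left hρ
  have r := h.isState_right hρ
  have l' := h'.isState_left hσ
  have r' := h'.isState_right hσ
  simp only [coherentInfoAt]
  rw [prodMap_kronecker, prodMap_kronecker, entropy_kronecker l.1.1 l'.1.1 l.2 l'.2,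
    entropy_kronecker r.1.1 r'.1.1 r.2 r'.2]
  ring

omit [DecidableEq b] in
theorem exists_isComplementary_tensorPower {Φ : MatMap a b}
    (hΦ : ∃ (n : ℕ) (Φc : MatMap a (Fin n)), IsComplementary Φ Φc) (n : ℕ) :
    ∃ (m : ℕ) (Φc : MatMap (Fin n → a) (Fin m)), IsComplementary (tensorPower Φ n) Φc := by
  induction n with
  | zero =>
    -- The zeroth power acts on a one-dimensional space, where the isometry is the scalar one.
    refine ⟨1, reindexMap (Equiv.refl _) (Equiv.ofUnique (Fin 1) (Fin 0 → b)) (tensorPower Φ 0),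
      isComplementary_iff_single.2 ⟨of fun _ _ => 1, ?_, fun k l => ⟨fun i j => ?_, fun c d => ?_⟩⟩⟩
    · ext p q
      rw [Subsingleton.elim p q]
      simp [mul_apply]
    · simp [tensorPower_single]
    · rw [reindexMap_single, tensorPower_single]
      simp
  | succ n ih =>
    obtain ⟨m, Φ₁, h₁⟩ := ih
    obtain ⟨m', Φ₂, h₂⟩ := hΦ
    rw [tensorPower_add, tensorPower_one]
    exact ⟨m * m', _, (h₁.prod (h₂.reindex (Equiv.funUnique (Fin 1) a) (Equiv.funUnique (Fin 1) b)
      (Equiv.refl _))).reindex _ _ finProdFinEquiv.symm⟩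

theorem coherentInfo_tensorPower_add_le [Nonempty a] {Φ : MatMap a b}
    (hΦ : ∃ (n : ℕ) (Φc : MatMap a (Fin n)), IsComplementary Φ Φc) (m n : ℕ) :
    coherentInfo (tensorPower Φ m) + coherentInfo (tensorPower Φ n) ≤
      coherentInfo (tensorPower Φ (m + n)) := by
  have hm := exists_isComplementary_tensorPower hΦ m
  have hn := exists_isComplementary_tensorPower hΦ n
  refine (coherentInfo_add_le_prodMap hm hn).trans ?_
  rw [tensorPower_add]
  refine coherentInfo_le_reindexMap ?_ _ _
  obtain ⟨p, Φ₁, h₁⟩ := hm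
  obtain ⟨q, Φ₂, h₂⟩ := hn
  exact ⟨p * q, _, (h₁.prod h₂).reindex (Equiv.refl _) (Equiv.refl _) finProdFinEquiv.symm⟩

/-- The regularized coherent information converges, and its limit is at least the coherent
information of a single copy. -/
theorem tendsto_capacitySeq [Nonempty a] {Φ : MatMap a b}
    (hΦ : ∃ (n : ℕ) (Φc : MatMap a (Fin n)), IsComplementary Φ Φc) :
    Tendsto (capacitySeq Φ) atTop (𝓝 (quantumCapacity Φ)) ∧ coherentInfo Φ ≤ quantumCapacity Φ := by
  -- Negation turns superadditivity into the form of Fekete's lemma.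
  have hsub : Subadditive fun n => -coherentInfo (tensorPower Φ n) := fun m n => by
    have := coherentInfo_tensorPower_add_le hΦ m n
    linarith
  have hbdd : BddBelow (Set.range fun n : ℕ => -coherentInfo (tensorPower Φ n) / n) := by
    refine ⟨-Real.log (Fintype.card b), ?_⟩
    rintro _ ⟨n, rfl⟩
    have h : coherentInfo (tensorPower Φ n) ≤ n * Real.log (Fintype.card b) := by
      refine coherentInfo_le (exists_isComplementary_tensorPower hΦ n) fun m Φc ρ h hρ => ?_
      refine (h.coherentInfoAt_le hρ).trans (le_of_eq ?_)
      simp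
    -- At `n = 0` the quotient is zero by convention, and the bound holds since the logarithm of a
    -- natural number is nonnegative.
    rcases n.eq_zero_or_pos with rfl | hn
    · simpa using Real.log_natCast_nonneg _
    · have hn' : (0 : ℝ) < n := by exact_mod_cast hn
      change _ ≤ _ / (n : ℝ)
      rw [le_div_iff₀ hn']
      linarith
  have hlim : Tendsto (capacitySeq Φ) atTop (𝓝 (-hsub.lim)) := by
    refine (hsub.tendsto_lim hbdd).neg.congr fun n => ?_
    rw [capacitySeq, neg_div, neg_neg]
  have hQ : quantumCapacity Φ = -hsub.lim := hlim.limUnder_eq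
  refine ⟨hQ ▸ hlim, ?_⟩
  have h₁ := hsub.lim_le_div hbdd one_ne_zero
  have h₂ : coherentInfo Φ ≤ coherentInfo (tensorPower Φ 1) := by
    rw [tensorPower_one]
    exact coherentInfo_le_reindexMap hΦ _ _
  rw [Nat.cast_one, div_one] at h₁
  rw [hQ]
  linarith

theorem IsComplementary.capacity_pos {n : ℕ} {Φ : MatMap a b} {Φc : MatMap a (Fin n)}
    (h : IsComplementary Φ Φc) {P : Matrix a a ℂ}
    (hP : IsPureState P) (hrank : (Φ P).rank = (Φc 1).rank) (hlt : (Φc 1).rank < (Φ 1).rank) :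
    Tendsto (capacitySeq Φ) atTop (𝓝 (quantumCapacity Φ)) ∧
      coherentInfo Φ ≤ quantumCapacity Φ ∧ 0 < coherentInfo Φ := by
  have : Nonempty a := by
    by_contra hne
    rw [not_nonempty_iff] at hne
    simpa [trace] using hP.isState.2
  obtain ⟨ρ, hρ, hpos⟩ := h.exists_coherentInfoAt_pos hP hrank hlt
  have ht := tendsto_capacitySeq ⟨n, Φc, h⟩
  exact ⟨ht.1, ht.2, hpos.trans_le (h.coherentInfoAt_le_coherentInfo hρ)⟩

end Capacity

end QuantumChannel

theorem corollary3p2 (d dout : ℕ) (Φ : QuantumChannel.MatMap (Fin d) (Fin dout))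
    (hΦ : QuantumChannel.IsChannel Φ)
    (hψ : ∃ P : Matrix (Fin d) (Fin d) ℂ, QuantumChannel.IsPureState P ∧
      (Φ P).rank = min (QuantumChannel.minOutDim Φ) (QuantumChannel.minEnvDim Φ)) :
    (QuantumChannel.minEnvDim Φ < QuantumChannel.minOutDim Φ →
      Tendsto (QuantumChannel.capacitySeq Φ) atTop (𝓝 (QuantumChannel.quantumCapacity Φ)) ∧
      QuantumChannel.coherentInfo Φ ≤ QuantumChannel.quantumCapacity Φ ∧
      0 < QuantumChannel.coherentInfo Φ) ∧
    (QuantumChannel.minOutDim Φ < QuantumChannel.minEnvDim Φ →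
      ∀ (denv : ℕ) (Φc : QuantumChannel.MatMap (Fin d) (Fin denv)),
        QuantumChannel.IsComplementary Φ Φc →
        Tendsto (QuantumChannel.capacitySeq Φc) atTop
          (𝓝 (QuantumChannel.quantumCapacity Φc)) ∧
        QuantumChannel.coherentInfo Φc ≤ QuantumChannel.quantumCapacity Φc ∧
        0 < QuantumChannel.coherentInfo Φc) := by
  obtain ⟨P, hP, hrank⟩ := hψ
  refine ⟨fun hlt => ?_, fun hlt denv Φc h => ?_⟩
  -- The infimum of the empty set in `ℕ` is zero, so a positive `minOutDim Φ` supplies a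
  -- complementary map.
  · obtain ⟨_, n, Φc, h, -⟩ := Nat.nonempty_of_pos_sInf (Nat.zero_lt_of_lt hlt)
    rw [min_eq_right hlt.le] at hrank
    rw [h.minEnvDim_eq] at hrank hlt
    rw [QuantumChannel.minOutDim_eq h] at hlt
    exact h.capacity_pos hP hrank hlt
  · rw [min_eq_left hlt.le] at hrank
    rw [QuantumChannel.minOutDim_eq h] at hrank hlt
    rw [h.minEnvDim_eq] at hlt
    -- The roles are exchanged: `rank_pure` carries the rank condition from `Φ P` to `Φc P`.
    exact h.symm.capacity_pos hP ((h.rank_pure hP).symm.trans hrank) hlt
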